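/- Let $T_n$ be the full transformation semigroup, i.e. the semigroup of all mappings from $\{1,\dots,n\}$ to itself under composition (from left to right), and let $E=E(T_n)$ be its set of idempotents. The free idempotent generated semigroup over $E$ is the semigroup given by the presentation $$\mathsf{IG}(E)=\langle\, E \mid e\cdot f = ef\ \ (e,f\in E,\ \{e,f\}\cap\{ef,fe\}\neq\emptyset)\,\rangle,$$ where in each relation the left-hand side $e\cdot f$ is a word of length $2$ and the right-hand side $ef\in E$ is the product in $T_n$, a word of length $1$. For $e\in E$, the element of $\mathsf{IG}(E)$ represented by the generator $e$ is idempotent; let $H_e$ denote the maximal subgroup of $\mathsf{IG}(E)$ containing it. Let $1\le r\le n-2$ and let $e\in E$ be an arbitrary idempotent with $|\operatorname{im} e|=r$. Then $H_e$ is isomorphic to the symmetric group $S_r$. -/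

import Mathlib

/-- The set of all mappings from an `n`-element set to itself. -/
def FullTransformation (n : ℕ) : Type := Fin n → Fin n

namespace FullTransformation

/-- Mappings are composed from left to right: `f * g` is "first `f`, then `g`". -/
instance instMonoid (n : ℕ) : Monoid (FullTransformation n) where
  mul f g := fun x => g (f x)
  one := fun x => x
  mul_assoc _ _ _ := rfl
  one_mul _ := rfl
  mul_one _ := rfl

theorem mul_apply {n : ℕ} (f g : FullTransformation n) (x : Fin n) : (f * g) x = g (f x) := rfl

/-- The rank of a mapping is the size of its image. -/
noncomputable def rank {n : ℕ} (f : FullTransformation n) : ℕ := (Set.range f).ncard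

end FullTransformation

/-- The set `E(S)` of idempotents of a semigroup `S`. -/
abbrev Idempotents (S : Type*) [Semigroup S] : Type _ := {x : S // IsIdempotentElem x}

/-- `{e, f} ∩ {ef, fe} ≠ ∅`. -/
def IsBasicPair {S : Type*} [Semigroup S] (e f : Idempotents S) : Prop :=
  (({e.1, f.1} : Set S) ∩ {e.1 * f.1, f.1 * e.1}).Nonempty

/-- The product of a basic pair of idempotents is again an idempotent. -/
theorem IsBasicPair.isIdempotentElem_mul {S : Type*} [Semigroup S] {e f : Idempotents S}
    (h : IsBasicPair e f) : IsIdempotentElem (e.1 * f.1) := by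
  obtain ⟨e, he⟩ := e
  obtain ⟨f, hf⟩ := f
  obtain ⟨x, hx, hx'⟩ := h
  simp only [Set.mem_insert_iff, Set.mem_singleton_iff] at hx hx'
  have aux : ∀ a : S, e * f * (e * f) = e * (f * e) * f := fun _ => by simp only [mul_assoc]
  unfold IsIdempotentElem at he hf ⊢
  rcases hx with rfl | rfl <;> rcases hx' with h | h
  · dsimp only at h ⊢
    rw [← h]; exact he
  · dsimp only at h ⊢
    rw [aux x, ← h, he]
  · dsimp only at h ⊢
    rw [← h]; exact hf
  · dsimp only at h ⊢
    rw [aux x, ← h, mul_assoc, hf]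

/-- The defining relations `e · f = ef`, for `e, f ∈ E` with `{e, f} ∩ {ef, fe} ≠ ∅`.
The left-hand side is a word of length 2, the right-hand side a word of length 1. -/
inductive IGRel (S : Type*) [Semigroup S] :
    FreeSemigroup (Idempotents S) → FreeSemigroup (Idempotents S) → Prop
  | basic (e f : Idempotents S) (h : IsBasicPair e f) :
      IGRel S (FreeSemigroup.of e * FreeSemigroup.of f)
        (FreeSemigroup.of ⟨e.1 * f.1, h.isIdempotentElem_mul⟩)

/-- The free idempotent generated semigroup `IG(E)` over the set `E` of idempotents of `S`:
the semigroup presented by generators `E` and relations `IGRel`. -/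
abbrev IG (S : Type*) [Semigroup S] : Type _ := (conGen (IGRel S)).Quotient

/-- The element of `IG(E)` represented by the generator `e ∈ E`. -/
def IG.of {S : Type*} [Semigroup S] (e : Idempotents S) : IG S :=
  ((FreeSemigroup.of e : FreeSemigroup (Idempotents S)) : (conGen (IGRel S)).Quotient)

theorem IG.of_mul_of {S : Type*} [Semigroup S] (e f : Idempotents S) (h : IsBasicPair e f) :
    IG.of e * IG.of f = IG.of ⟨e.1 * f.1, h.isIdempotentElem_mul⟩ :=
  (Con.eq _).2 (ConGen.Rel.of _ _ (IGRel.basic e f h))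

theorem IG.isIdempotentElem_of {S : Type*} [Semigroup S] (e : Idempotents S) :
    IsIdempotentElem (IG.of e) := by
  have he : e.1 * e.1 = e.1 := e.2
  have h : IsBasicPair e e := ⟨e.1, by simp, by simp [he]⟩
  have h2 := IG.of_mul_of e e h
  have h3 : (⟨e.1 * e.1, h.isIdempotentElem_mul⟩ : Idempotents S) = e := Subtype.ext he
  rw [h3] at h2
  exact h2

/-- A subsemigroup that is a group under the multiplication of the ambient semigroup. -/
def Subsemigroup.IsGroup {S : Type*} [Semigroup S] (G : Subsemigroup S) : Prop :=
  ∃ u ∈ G, ∀ x ∈ G, u * x = x ∧ x * u = x ∧ ∃ y ∈ G, x * y = u ∧ y * x = u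

/-- The maximal subgroup of `S` containing the idempotent `e`, as the set of units of the local
monoid `eSe`. See `maximalSubgroup_isGreatest`. -/
def maximalSubgroup {S : Type*} [Semigroup S] (e : S) (he : IsIdempotentElem e) :
    Subsemigroup S where
  carrier := {x | e * x = x ∧ x * e = x ∧ ∃ y, e * y = y ∧ y * e = y ∧ x * y = e ∧ y * x = e}
  mul_mem' := by
    rintro a b ⟨ha, ha', a', h1, h2, h3, h4⟩ ⟨hb, hb', b', h5, h6, h7, h8⟩
    refine ⟨by rw [← mul_assoc, ha], by rw [mul_assoc, hb'], b' * a', by rw [← mul_assoc, h5],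
      by rw [mul_assoc, h2], ?_, ?_⟩
    · rw [mul_assoc, ← mul_assoc b, h7, h1, h3]
    · rw [mul_assoc, ← mul_assoc a', h4, hb, h8]

theorem mem_maximalSubgroup {S : Type*} [Semigroup S] {e : S} {he : IsIdempotentElem e} {x : S} :
    x ∈ maximalSubgroup e he ↔
      e * x = x ∧ x * e = x ∧ ∃ y, e * y = y ∧ y * e = y ∧ x * y = e ∧ y * x = e := Iff.rfl

/-- `maximalSubgroup e he` is the largest among the subgroups of `S` containing `e`. -/
theorem maximalSubgroup_isGreatest {S : Type*} [Semigroup S] (e : S) (he : IsIdempotentElem e) :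
    IsGreatest {G : Subsemigroup S | G.IsGroup ∧ e ∈ G} (maximalSubgroup e he) := by
  have hee : e ∈ maximalSubgroup e he := ⟨he, he, e, he, he, he, he⟩
  refine ⟨⟨⟨e, hee, ?_⟩, hee⟩, ?_⟩
  · rintro x ⟨h1, h2, y, h3, h4, h5, h6⟩
    exact ⟨h1, h2, y, ⟨h3, h4, x, h1, h2, h6, h5⟩, h5, h6⟩
  · rintro G ⟨⟨u, -, hG⟩, heG⟩ x hx
    have hu : e = u := by
      obtain ⟨h1, -, y, -, h3, -⟩ := hG e heG
      have he' : e * e = e := he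
      rw [← h3, ← he', mul_assoc, h3, he', hG e heG |>.2.1]
    subst hu
    obtain ⟨h1, h2, y, hy, h3, h4⟩ := hG x hx
    exact ⟨h1, h2, y, (hG y hy).1, (hG y hy).2.1, h3, h4⟩

/-! Fix `e` of rank `r`. Elements `y` of `IG(E)` with `e y = y` are sorted by the placement `a` of
`r` tokens to which they carry the image of `e`. If `y` absorbs the idempotents fixing `a`, then
multiplying by an idempotent taking `a` to `b` gives a result depending only on `y`, `a` and `b`;
such an idempotent exists exactly when `a` and `b` are compatible. These moves compose on pairwise
compatible triples, so they act like a covering of the complex of placements, with compatible pairs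
as edges and compatible triples as triangles.

With two vacant positions there is no monodromy: `exists_isFlat` gives a flat section through any
point, by a van Kampen style induction. By `isFlat_mul`, right multiplication acts on the section as
mappings act on placements. Hence an element of `H_e` is determined by its permutation of the image
of `e`, and every permutation occurs. -/

/-- Two placements of tokens `ι` on positions `X` are compatible if no position is used by
different tokens of the two placements. -/
def Compatible {ι X : Type*} (a b : ι ↪ X) : Prop := ∀ i j, i ≠ j → a i ≠ b j

namespace Compatible

variable {ι X : Type*} {a b : ι ↪ X}

theorem refl (a : ι ↪ X) : Compatible a a := fun _ _ hij h => hij (a.injective h)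

theorem symm (h : Compatible a b) : Compatible b a := fun i j hij hh => h j i hij.symm hh.symm

theorem eq_of_eq (h : Compatible a b) {i j : ι} (hij : a i = b j) : i = j := by
  by_contra hne
  exact h i j hne hij

end Compatible

section SetValue

variable {ι X : Type*} [DecidableEq ι] [DecidableEq X]

theorem compatible_setValue {a b : ι ↪ X} {i : ι} {p : X} (h : Compatible a b)
    (ha : ∀ j, j ≠ i → a j ≠ p) (hb : ∀ j, j ≠ i → b j ≠ p) :
    Compatible (a.setValue i p) b := by
  intro j k hjk
  by_cases hj : j = i
  · subst hj
    rw [Function.Embedding.setValue_eq]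
    exact (hb k hjk.symm).symm
  · rw [Function.Embedding.setValue_eq_of_ne hj (ha j hj)]
    exact h j k hjk

end SetValue

/-! ### Flat sections over the complex of placements. -/

/-- Fibres over the placements, with transport maps along compatible pairs that commute on
pairwise compatible triples. -/
structure TransportSystem (ι X Y : Type*) where
  fib : (ι ↪ X) → Set Y
  map : ∀ a b : ι ↪ X, Compatible a b → Y → Y
  map_mem : ∀ a b (h : Compatible a b), ∀ y ∈ fib a, map a b h y ∈ fib b
  map_refl : ∀ a (h : Compatible a a), ∀ y ∈ fib a, map a a h y = y
  map_map : ∀ a b c (hab : Compatible a b) (hbc : Compatible b c) (hac : Compatible a c),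
    ∀ y ∈ fib a, map b c hbc (map a b hab y) = map a c hac y

namespace TransportSystem

variable {ι X Y : Type*} (T : TransportSystem ι X Y)

/-- A section over a set of placements that is preserved by transport. -/
structure IsFlat (S : Set (ι ↪ X)) (s : (ι ↪ X) → Y) : Prop where
  mem : ∀ a ∈ S, s a ∈ T.fib a
  map_eq : ∀ a ∈ S, ∀ b ∈ S, ∀ h : Compatible a b, T.map a b h (s a) = s b

variable {T}

/-- The placements that agree with `a₀` outside `J`. -/
def agreeing (J : Finset ι) (a₀ : ι ↪ X) : Set (ι ↪ X) := {a | ∀ j, j ∉ J → a j = a₀ j}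

theorem self_mem_agreeing (J : Finset ι) (a₀ : ι ↪ X) : a₀ ∈ agreeing J a₀ := fun _ _ => rfl

theorem exists_vacant_ne [Fintype ι] [Fintype X] (hX : Fintype.card ι + 2 ≤ Fintype.card X)
    (a : ι ↪ X) (p : X) : ∃ v, v ≠ p ∧ ∀ i, a i ≠ v := by
  classical
  by_contra! h
  have : (Finset.univ : Finset X) ⊆ insert p (Finset.univ.image a) := by
    intro x _
    by_cases hx : x = p
    · simp [hx]
    · obtain ⟨i, hi⟩ := h x hx
      simp [← hi]
  have h1 := Finset.card_le_card this
  have h2 := Finset.card_insert_le p (Finset.univ.image a)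
  have h3 := Finset.card_image_le (s := Finset.univ) (f := a)
  simp only [Finset.card_univ] at h1 h3
  omega

/-- Flat sections over the placements avoiding `p` are determined by one value. -/
theorem IsFlat.eq_of_eq [Fintype ι] [Fintype X] (hX : Fintype.card ι + 2 ≤ Fintype.card X)
    {J : Finset ι} {a₀ : ι ↪ X}
    {p : X} {s t : (ι ↪ X) → Y}
    (hs : T.IsFlat {a | a ∈ agreeing J a₀ ∧ ∀ i, a i ≠ p} s)
    (ht : T.IsFlat {a | a ∈ agreeing J a₀ ∧ ∀ i, a i ≠ p} t)
    {b : ι ↪ X} (hb : b ∈ agreeing J a₀) (hbp : ∀ i, b i ≠ p) :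
    ∀ a ∈ agreeing J a₀, (∀ i, a i ≠ p) → s a = t a → s b = t b := by
  classical
  have step : ∀ a ∈ agreeing J a₀, (∀ i, a i ≠ p) → s a = t a → ∀ i ∈ J, ∀ v, v ≠ p →
      (∀ j, a j ≠ v) → a.setValue i v ∈ agreeing J a₀ ∧ (∀ j, a.setValue i v j ≠ p) ∧
        s (a.setValue i v) = t (a.setValue i v) := by
    intro a ha hap hst i hi v hvp hv
    have h1 : a.setValue i v ∈ agreeing J a₀ := by
      intro j hj
      rw [Function.Embedding.setValue_eq_of_ne (by rintro rfl; exact hj hi) (hv j), ha j hj]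
    have h2 : ∀ j, a.setValue i v j ≠ p := by
      intro j
      by_cases hj : j = i
      · rwa [hj, Function.Embedding.setValue_eq]
      · rw [Function.Embedding.setValue_eq_of_ne hj (hv j)]
        exact hap j
    have hc : Compatible a (a.setValue i v) :=
      (compatible_setValue (Compatible.refl a) (fun j _ => hv j) (fun j _ => hv j)).symm
    refine ⟨h1, h2, ?_⟩
    rw [← hs.map_eq a ⟨ha, hap⟩ _ ⟨h1, h2⟩ hc, ← ht.map_eq a ⟨ha, hap⟩ _ ⟨h1, h2⟩ hc, hst]
  -- Induction on the set of tokens that `a` and `b` place differently.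
  intro a
  induction h : (Finset.univ.filter fun i => a i ≠ b i) using Finset.strongInduction
    generalizing a with
  | H D ih =>
    intro ha hap hst
    by_cases hab : a = b
    · rwa [← hab]
    obtain ⟨i, hi⟩ : ∃ i, a i ≠ b i := by
      by_contra! hh
      exact hab (Function.Embedding.ext hh)
    have hJ : ∀ i, a i ≠ b i → i ∈ J := by
      intro i hi
      by_contra hJ
      exact hi (by rw [ha i hJ, hb i hJ])
    -- once the target of `i` is free, move `i` there
    have key : ∀ c ∈ agreeing J a₀, (∀ k, c k ≠ p) → s c = t c → (∀ k, c k ≠ b i) →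
        (∀ k, a k = b k → c k = b k) → s b = t b := by
      intro c hc hcp hcst hci hcb
      obtain ⟨h1, h2, h3⟩ := step c hc hcp hcst i (hJ i hi) (b i) (hbp i) hci
      refine ih _ ?_ _ rfl h1 h2 h3
      rw [← h]
      refine Finset.ssubset_iff_of_subset ?_ |>.2 ⟨i, ?_, ?_⟩
      · intro k hk
        simp only [Finset.mem_filter, Finset.mem_univ, true_and] at hk ⊢
        intro hk'
        apply hk
        have hki : k ≠ i := by
          rintro rfl
          exact hi hk'
        rw [Function.Embedding.setValue_eq_of_ne hki (hci k), hcb k hk']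
      · simpa using hi
      · simp
    by_cases hocc : ∀ k, a k ≠ b i
    · exact key a ha hap hst hocc fun k hk => hk
    · push Not at hocc
      obtain ⟨j, hj⟩ := hocc
      have hij : i ≠ j := by
        rintro rfl
        exact hi hj
      have hjb : a j ≠ b j := by
        rw [hj]
        exact fun hh => hij (b.injective hh)
      -- Token `j` blocks the target of `i`. It is itself misplaced, so parking it at `v` misplaces
      -- no further token. Avoiding `p` here is what requires the second vacancy.
      obtain ⟨v, hvp, hv⟩ := exists_vacant_ne hX a p
      obtain ⟨h1, h2, h3⟩ := step a ha hap hst j (hJ j hjb) v hvp hv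
      refine key _ h1 h2 h3 (fun k => ?_) (fun k hk => ?_)
      · by_cases hk : k = j
        · rw [hk, Function.Embedding.setValue_eq, ← hj]
          exact (hv j).symm
        · rw [Function.Embedding.setValue_eq_of_ne hk (hv k), ← hj]
          exact fun hh => hk (a.injective hh)
      · have hkj : k ≠ j := by
          rintro rfl
          exact hjb hk
        rw [Function.Embedding.setValue_eq_of_ne hkj (hv k), hk]

/-- The placements in which only `i` may sit at `p` retract onto those in which it does. -/
theorem IsFlat.extend [DecidableEq ι] [DecidableEq X] {J : Finset ι} {a₀ : ι ↪ X}
    {p : X} (hp : ∀ i, a₀ i ≠ p) {i : ι} {y : Y} (hy : y ∈ T.fib a₀)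
    (hc : Compatible a₀ (a₀.setValue i p)) {t : (ι ↪ X) → Y}
    (ht : T.IsFlat (agreeing (J.erase i) (a₀.setValue i p)) t)
    (hty : t (a₀.setValue i p) = T.map _ _ hc y) :
    ∃ s, T.IsFlat {a | a ∈ agreeing J a₀ ∧ ∀ j, j ≠ i → a j ≠ p} s ∧ s a₀ = y := by
  have hmem : ∀ a ∈ agreeing J a₀, (∀ j, j ≠ i → a j ≠ p) →
      a.setValue i p ∈ agreeing (J.erase i) (a₀.setValue i p) := by
    intro a ha hap j hj
    by_cases hji : j = i
    · rw [hji, Function.Embedding.setValue_eq, Function.Embedding.setValue_eq]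
    · rw [Function.Embedding.setValue_eq_of_ne hji (hap j hji),
        Function.Embedding.setValue_eq_of_ne hji (hp j)]
      exact ha j fun hJ => hj (Finset.mem_erase.2 ⟨hji, hJ⟩)
  have hcomp : ∀ {a b : ι ↪ X}, Compatible a b → (∀ j, j ≠ i → a j ≠ p) →
      (∀ j, j ≠ i → b j ≠ p) → Compatible (a.setValue i p) b := compatible_setValue
  have hset : ∀ {a : ι ↪ X}, (∀ j, j ≠ i → a j ≠ p) → ∀ j, j ≠ i → a.setValue i p j ≠ p := by
    intro a ha j hj
    rw [Function.Embedding.setValue_eq_of_ne hj (ha j hj)]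
    exact ha j hj
  classical
  -- The value at `a` is transported from its retract `a.setValue i p`; the default `y` is never
  -- taken on the set in question.
  refine ⟨fun a => if h : Compatible (a.setValue i p) a then
    T.map _ _ h (t (a.setValue i p)) else y, ⟨?_, ?_⟩, ?_⟩
  · rintro a ⟨ha, hap⟩
    have h := hcomp (Compatible.refl a) hap hap
    rw [dif_pos h]
    exact T.map_mem _ _ _ _ (ht.mem _ (hmem a ha hap))
  · rintro a ⟨ha, hap⟩ b ⟨hb, hbp⟩ hab
    have h := hcomp (Compatible.refl a) hap hap
    have h' := hcomp (Compatible.refl b) hbp hbp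
    have h1 := hcomp hab hap hbp
    have h2 := (hcomp h1.symm hbp (hset hap)).symm
    have hta := ht.mem _ (hmem a ha hap)
    -- Both routes from the retract of `a` to `b`, through `a` and through the retract of `b`, equal
    -- the direct transport.
    rw [dif_pos h, dif_pos h', T.map_map _ _ _ h hab h1 _ hta,
      ← T.map_map _ _ _ h2 h' h1 _ hta, ht.map_eq _ (hmem a ha hap) _ (hmem b hb hbp)]
  · dsimp only
    rw [dif_pos hc.symm, hty, T.map_map _ _ _ _ _ (Compatible.refl a₀) _ hy, T.map_refl _ _ _ hy]

/-- A transport system with at least two vacant positions has a flat section through every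
point. -/
theorem exists_isFlat_agreeing [Fintype ι] [Fintype X]
    (hX : Fintype.card ι + 2 ≤ Fintype.card X) (J : Finset ι) : ∀ (a₀ : ι ↪ X), ∀ y ∈ T.fib a₀,
    ∃ s, T.IsFlat (agreeing J a₀) s ∧ s a₀ = y := by
  classical
  induction J using Finset.strongInduction with
  | H J ih =>
    intro a₀ y hy
    have : Nonempty Y := ⟨y⟩
    by_cases hJ : J.Nonempty
    swap
    · have hS : ∀ a ∈ agreeing J a₀, a = a₀ := fun a ha =>
        Function.Embedding.ext fun j => ha j fun hj => hJ ⟨j, hj⟩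
      refine ⟨fun _ => y, ⟨fun a ha => hS a ha ▸ hy, fun a ha b hb h => ?_⟩, rfl⟩
      obtain rfl := hS a ha
      obtain rfl := hS b hb
      exact T.map_refl _ _ _ hy
    obtain ⟨i₀, hi₀⟩ := hJ
    -- Only the vacancy of `p` matters; the excluded point is occupied anyway.
    obtain ⟨p, -, hp⟩ := exists_vacant_ne hX a₀ (a₀ i₀)
    have h1 : ∀ i ∈ J, ∃ s, T.IsFlat {a | a ∈ agreeing J a₀ ∧ ∀ j, j ≠ i → a j ≠ p} s ∧
        s a₀ = y := by
      intro i hi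
      have hc : Compatible a₀ (a₀.setValue i p) :=
        (compatible_setValue (Compatible.refl _) (fun j _ => hp j) (fun j _ => hp j)).symm
      obtain ⟨t, ht, hty⟩ := ih _ (Finset.erase_ssubset hi) (a₀.setValue i p)
        (T.map _ _ hc y) (T.map_mem _ _ _ _ hy)
      exact IsFlat.extend hp hy hc ht hty
    choose! s hs hsy using h1
    -- The pieces overlap in the placements avoiding `p`, which single moves connect.
    have hagree : ∀ i ∈ J, ∀ j ∈ J, ∀ b ∈ agreeing J a₀, (∀ k, b k ≠ p) → s i b = s j b := by
      intro i hi j hj b hb hbp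
      have hres : ∀ i ∈ J, T.IsFlat {a | a ∈ agreeing J a₀ ∧ ∀ i, a i ≠ p} (s i) :=
        fun i hi => ⟨fun a ha => (hs i hi).mem a ⟨ha.1, fun j _ => ha.2 j⟩,
          fun a ha b hb h => (hs i hi).map_eq a ⟨ha.1, fun j _ => ha.2 j⟩ b
            ⟨hb.1, fun j _ => hb.2 j⟩ h⟩
      exact IsFlat.eq_of_eq hX (hres i hi) (hres j hj) hb hbp a₀ (self_mem_agreeing J a₀) hp
        (by rw [hsy i hi, hsy j hj])
    have hocc : ∀ a ∈ agreeing J a₀, ∀ i, a i = p → i ∈ J := by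
      intro a ha i hi
      by_contra hJ
      exact hp i (by rw [← ha i hJ, hi])
    let f : (ι ↪ X) → Y := fun a => if h : ∃ i, a i = p then s h.choose a else s i₀ a
    have hf : ∀ i ∈ J, ∀ a ∈ agreeing J a₀, (∀ j, j ≠ i → a j ≠ p) → f a = s i a := by
      intro i hi a ha hap
      by_cases h : ∃ i, a i = p
      · have : h.choose = i := by
          by_contra hne
          exact hap _ hne h.choose_spec
        simp only [f, dif_pos h, this]
      · simp only [f, dif_neg h]
        push Not at h
        exact hagree i₀ hi₀ i hi a ha h
    -- In a compatible pair at most one token uses `p`, so every edge lies in a single piece and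
    -- flatness can be checked there.
    have hcov : ∀ a ∈ agreeing J a₀, ∀ b ∈ agreeing J a₀, Compatible a b → ∃ i ∈ J,
        (∀ j, j ≠ i → a j ≠ p) ∧ ∀ j, j ≠ i → b j ≠ p := by
      intro a ha b hb hab
      by_cases h : ∃ i, a i = p
      · obtain ⟨i, hi⟩ := h
        exact ⟨i, hocc a ha i hi, fun j hj hh => hj (a.injective (hh.trans hi.symm)),
          fun j hj hh => hj (hab.symm.eq_of_eq (hh.trans hi.symm))⟩
      · push Not at h
        by_cases h' : ∃ i, b i = p
        · obtain ⟨i, hi⟩ := h'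
          exact ⟨i, hocc b hb i hi, fun j _ => h j,
            fun j hj hh => hj (b.injective (hh.trans hi.symm))⟩
        · push Not at h'
          exact ⟨i₀, hi₀, fun j _ => h j, fun j _ => h' j⟩
    refine ⟨f, ⟨fun a ha => ?_, fun a ha b hb hab => ?_⟩, ?_⟩
    · obtain ⟨i, hi, hia, -⟩ := hcov a ha a ha (Compatible.refl a)
      rw [hf i hi a ha hia]
      exact (hs i hi).mem a ⟨ha, hia⟩
    · obtain ⟨i, hi, hia, hib⟩ := hcov a ha b hb hab
      rw [hf i hi a ha hia, hf i hi b hb hib]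
      exact (hs i hi).map_eq a ⟨ha, hia⟩ b ⟨hb, hib⟩ hab
    · rw [hf i₀ hi₀ a₀ (self_mem_agreeing J a₀) fun j _ => hp j, hsy i₀ hi₀]

theorem exists_isFlat [Fintype ι] [Fintype X] (hX : Fintype.card ι + 2 ≤ Fintype.card X)
    {a₀ : ι ↪ X} {y : Y}
    (hy : y ∈ T.fib a₀) : ∃ s, T.IsFlat Set.univ s ∧ s a₀ = y := by
  have h : agreeing Finset.univ a₀ = Set.univ := by
    ext a
    simp [agreeing]
  simpa only [h] using exists_isFlat_agreeing (T := T) hX Finset.univ a₀ y hy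

end TransportSystem

/-! ### Multiplication by idempotents in `IG(E)`. -/

namespace IG

section Semigroup

variable {S : Type*} [Semigroup S]

theorem of_mul_of_eq {e f g : Idempotents S} (h : IsBasicPair e f) (hg : e.1 * f.1 = g.1) :
    of e * of f = of g := by
  rw [of_mul_of e f h]
  exact congrArg of (Subtype.ext hg)

theorem of_mul_of_eq_left {e f : Idempotents S} (h : e.1 * f.1 = e.1) : of e * of f = of e :=
  of_mul_of_eq ⟨e.1, by simp, by simp [h]⟩ h

theorem of_mul_of_eq_right {e f : Idempotents S} (h : e.1 * f.1 = f.1) : of e * of f = of f :=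
  of_mul_of_eq ⟨f.1, by simp, by simp [h]⟩ h

/-- The natural homomorphism from `IG(E)` to the semigroup `S`. -/
def toSemigroup : IG S →ₙ* S where
  toFun x := Con.liftOn x (FreeSemigroup.lift Subtype.val) fun a b h => by
    induction h with
    | of a b h =>
      obtain ⟨e, f, h⟩ := h
      rw [map_mul]
      rfl
    | refl => rfl
    | symm _ h => exact h.symm
    | trans _ _ h h' => exact h.trans h'
    | mul _ _ h h' => rw [map_mul, map_mul, h, h']
  map_mul' x y := Con.induction_on₂ x y fun a b => map_mul _ a b

theorem toSemigroup_of (e : Idempotents S) : toSemigroup (of e) = e.1 := rfl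

@[elab_as_elim]
theorem induction_on {p : IG S → Prop} (x : IG S) (of : ∀ e, p (of e))
    (of_mul : ∀ e x, p x → p (IG.of e * x)) : p x :=
  Con.induction_on x fun w => FreeSemigroup.recOnMul w of fun e w _ h => of_mul e w h

end Semigroup

variable {n r : ℕ}

theorem toSemigroup_mul_apply (x y : IG (FullTransformation n)) (i : Fin n) :
    toSemigroup (x * y) i = toSemigroup y (toSemigroup x i) :=
  congrFun (map_mul toSemigroup x y) i

/-- The idempotent mapping with the given underlying function. -/
def idempotentOfFun (f : Fin n → Fin n) (hf : ∀ x, f (f x) = f x) :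
    Idempotents (FullTransformation n) := ⟨f, funext hf⟩

theorem idempotent_apply_apply (f : Idempotents (FullTransformation n)) (x : Fin n) :
    f.1 (f.1 x) = f.1 x := congrFun f.2 x

open Classical in
/-- The idempotent mapping that sends `a i` to `b i` and fixes all other points. -/
noncomputable def slide (a b : Fin r ↪ Fin n) (h : Compatible a b) :
    Idempotents (FullTransformation n) :=
  idempotentOfFun (Function.extend a b id) fun x => by
    by_cases hx : ∃ i, a i = x
    · obtain ⟨i, rfl⟩ := hx
      rw [a.injective.extend_apply]
      by_cases hb : ∃ j, a j = b i
      · obtain ⟨j, hj⟩ := hb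
        rw [← hj, a.injective.extend_apply, hj, h.eq_of_eq hj]
      · rw [Function.extend_apply' _ _ _ hb, id]
    · simp only [Function.extend_apply' _ _ _ hx, id]

theorem slide_apply (a b : Fin r ↪ Fin n) (h : Compatible a b) (i : Fin r) :
    (slide a b h).1 (a i) = b i := a.injective.extend_apply b id i

theorem slide_apply_of_forall_ne (a b : Fin r ↪ Fin n) (h : Compatible a b) {x : Fin n}
    (hx : ∀ i, a i ≠ x) : (slide a b h).1 x = x :=
  Function.extend_apply' b id x fun ⟨i, hi⟩ => hx i hi

/-- `y` absorbs on the right all idempotents fixing the points `a i`. -/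
def Absorbs (y : IG (FullTransformation n)) (a : Fin r ↪ Fin n) : Prop :=
  ∀ f : Idempotents (FullTransformation n), (∀ i, f.1 (a i) = a i) → y * of f = y

/-- The product of `y` with an idempotent only depends on the effect on the points `a i`. -/
theorem Absorbs.mul_of_eq_mul_slide {y : IG (FullTransformation n)} {a b : Fin r ↪ Fin n}
    (hy : Absorbs y a) (h : Compatible a b) {f : Idempotents (FullTransformation n)}
    (hf : ∀ i, f.1 (a i) = b i) : y * of f = y * of (slide a b h) := by
  have hfb : ∀ i, f.1 (b i) = b i := fun i => by rw [← hf, idempotent_apply_apply]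
  -- Redirect `f` so that points sent to `b i` go to `a i`. Then `y q = y`, while `q` forms basic
  -- pairs with `f` and with the slide and has the same product with both.
  let q₀ : Fin n → Fin n := fun x => Function.extend b a id (f.1 x)
  have hq₀ : ∀ i x, f.1 x = b i → q₀ x = a i := fun i x hx => by
    simp only [q₀, hx, b.injective.extend_apply]
  have hq₁ : ∀ x, (∀ i, b i ≠ f.1 x) → q₀ x = f.1 x := fun x hx =>
    Function.extend_apply' _ _ _ fun ⟨i, hi⟩ => hx i hi
  let q : Idempotents (FullTransformation n) := idempotentOfFun q₀ fun x => by
    by_cases hx : ∃ i, b i = f.1 x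
    · obtain ⟨i, hi⟩ := hx
      rw [hq₀ i x hi.symm, hq₀ i _ (hf i)]
    · push Not at hx
      rw [hq₁ x hx, hq₁ _ (by rwa [idempotent_apply_apply]), idempotent_apply_apply]
  have hyq : y * of q = y := hy q fun i => hq₀ i _ (hf i)
  have hfq : f.1 * q.1 = q.1 := funext fun x => by
    change q₀ (f.1 x) = q₀ x
    simp only [q₀, idempotent_apply_apply]
  have hsq : (slide a b h).1 * q.1 = q.1 := funext fun x => by
    change q₀ ((slide a b h).1 x) = q₀ x
    by_cases hx : ∃ i, a i = x
    · obtain ⟨i, rfl⟩ := hx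
      rw [slide_apply, hq₀ i _ (hfb i), hq₀ i _ (hf i)]
    · push Not at hx
      rw [slide_apply_of_forall_ne _ _ _ hx]
  have hqq : q.1 * f.1 = q.1 * (slide a b h).1 := funext fun x => by
    change f.1 (q₀ x) = (slide a b h).1 (q₀ x)
    by_cases hx : ∃ i, b i = f.1 x
    · obtain ⟨i, hi⟩ := hx
      rw [hq₀ i x hi.symm, hf, slide_apply]
    · push Not at hx
      rw [hq₁ x hx, slide_apply_of_forall_ne, idempotent_apply_apply]
      intro i hi
      apply hx i
      rw [← hf, hi, idempotent_apply_apply]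
  have hb₁ : IsBasicPair q f := ⟨q.1, by simp, by simp [hfq]⟩
  have hb₂ : IsBasicPair q (slide a b h) := ⟨q.1, by simp, by simp [hsq]⟩
  rw [← hyq, mul_assoc, mul_assoc, of_mul_of q f hb₁,
    of_mul_of_eq (g := ⟨_, hb₁.isIdempotentElem_mul⟩) hb₂ hqq.symm]

theorem compatible_of_apply {a b : Fin r ↪ Fin n} {f : Idempotents (FullTransformation n)}
    (hf : ∀ i, f.1 (a i) = b i) : Compatible a b := fun i j hij hh => hij <| b.injective <| by
  rw [← hf, hh, ← hf, idempotent_apply_apply]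

theorem Absorbs.mul_of_congr {y : IG (FullTransformation n)} {a b : Fin r ↪ Fin n}
    (hy : Absorbs y a) {f g : Idempotents (FullTransformation n)}
    (hf : ∀ i, f.1 (a i) = b i) (hg : ∀ i, g.1 (a i) = b i) : y * of f = y * of g := by
  have h := compatible_of_apply hf
  rw [hy.mul_of_eq_mul_slide h hf, hy.mul_of_eq_mul_slide h hg]

/-- `f` can be replaced by an idempotent `g` whose image is exactly the points of `b`; then `g p =
g` for every `p` fixing them. -/
theorem Absorbs.mul_of {y : IG (FullTransformation n)} {a b : Fin r ↪ Fin n} (hr : 0 < r)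
    (hy : Absorbs y a) {f : Idempotents (FullTransformation n)}
    (hf : ∀ i, f.1 (a i) = b i) : Absorbs (y * of f) b := by
  classical
  have hab := compatible_of_apply hf
  -- The default `b ⟨0, hr⟩` only keeps the image inside `b`.
  let k : Fin n → Fin n := fun x =>
    if x ∈ Set.range b then x else if x ∈ Set.range a then (slide a b hab).1 x else b ⟨0, hr⟩
  have hkb : ∀ i, k (b i) = b i := fun i => if_pos ⟨i, rfl⟩
  have hka : ∀ i, k (a i) = b i := fun i => by
    by_cases h : a i ∈ Set.range b
    · obtain ⟨j, hj⟩ := h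
      have := hab.eq_of_eq hj.symm
      subst this
      rw [← hj, hkb]
    · simp only [k, if_neg h, Set.mem_range_self, if_true, slide_apply]
  have hk : ∀ x, ∃ i, k x = b i := fun x => by
    by_cases hx : x ∈ Set.range b
    · obtain ⟨i, rfl⟩ := hx
      exact ⟨i, hkb i⟩
    by_cases hx' : x ∈ Set.range a
    · obtain ⟨i, rfl⟩ := hx'
      exact ⟨i, hka i⟩
    · exact ⟨⟨0, hr⟩, by simp only [k, if_neg hx, if_neg hx']⟩
  let g : Idempotents (FullTransformation n) := idempotentOfFun k fun x => by
    obtain ⟨i, hi⟩ := hk x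
    rw [hi, hkb]
  intro p hp
  have hgp : g.1 * p.1 = g.1 := funext fun x => by
    change p.1 (k x) = k x
    obtain ⟨i, hi⟩ := hk x
    rw [hi, hp]
  rw [hy.mul_of_congr hf (g := g) hka, mul_assoc, of_mul_of_eq_left hgp]

/-- Pairwise compatibility lets one idempotent collapse all three placements at once. The collapses
`m` onto `b` and `l` onto `c` replace the slides, and `m l = l` comes from a defining relation. -/
theorem Absorbs.mul_slide_mul_slide {y : IG (FullTransformation n)} {a b c : Fin r ↪ Fin n}
    (hr : 0 < r) (hy : Absorbs y a) (hab : Compatible a b) (hbc : Compatible b c)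
    (hac : Compatible a c) :
    y * of (slide a b hab) * of (slide b c hbc) = y * of (slide a c hac) := by
  classical
  -- two idempotents with the same kernel moving all three placements to `b` and to `c`
  have key : ∀ d : Fin r ↪ Fin n, Compatible a d → Compatible b d → Compatible c d →
      ∃ m : Idempotents (FullTransformation n), (∀ i, m.1 (a i) = d i) ∧ (∀ i, m.1 (b i) = d i) ∧
        (∀ i, m.1 (c i) = d i) ∧ ∀ x, (∀ i, a i ≠ x) → (∀ i, b i ≠ x) → (∀ i, c i ≠ x) →
          m.1 x = x := by
    intro d had hbd hcd
    let k : Fin n → Fin n := fun x => if x ∈ Set.range a then (slide a d had).1 x else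
      if x ∈ Set.range b then (slide b d hbd).1 x else
      if x ∈ Set.range c then (slide c d hcd).1 x else x
    have hka : ∀ i, k (a i) = d i := fun i => by simp [k, slide_apply]
    have hkb : ∀ i, k (b i) = d i := fun i => by
      by_cases h : ∃ j, a j = b i
      · obtain ⟨j, hj⟩ := h
        rw [← hj, hka, hab.eq_of_eq hj]
      · simp [k, h, slide_apply]
    have hkc : ∀ i, k (c i) = d i := fun i => by
      by_cases h : ∃ j, a j = c i
      · obtain ⟨j, hj⟩ := h
        rw [← hj, hka, hac.eq_of_eq hj]
      by_cases h' : ∃ j, b j = c i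
      · obtain ⟨j, hj⟩ := h'
        rw [← hj, hkb, hbc.eq_of_eq hj]
      · simp [k, h, h', slide_apply]
    have hk : ∀ x, (∀ i, a i ≠ x) → (∀ i, b i ≠ x) → (∀ i, c i ≠ x) → k x = x := by
      intro x ha hb hc
      simp [k, ha, hb, hc]
    have hkd : ∀ i, k (d i) = d i := fun i => by
      by_cases h : ∃ j, a j = d i
      · obtain ⟨j, hj⟩ := h
        rw [← hj, hka, had.eq_of_eq hj, ← hj, had.eq_of_eq hj]
      by_cases h' : ∃ j, b j = d i
      · obtain ⟨j, hj⟩ := h'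
        rw [← hj, hkb, hbd.eq_of_eq hj, ← hj, hbd.eq_of_eq hj]
      by_cases h'' : ∃ j, c j = d i
      · obtain ⟨j, hj⟩ := h''
        rw [← hj, hkc, hcd.eq_of_eq hj, ← hj, hcd.eq_of_eq hj]
      push Not at h h' h''
      exact hk _ h h' h''
    refine ⟨idempotentOfFun k fun x => ?_, hka, hkb, hkc, hk⟩
    by_cases ha : ∃ i, a i = x
    · obtain ⟨i, rfl⟩ := ha
      rw [hka, hkd]
    by_cases hb : ∃ i, b i = x
    · obtain ⟨i, rfl⟩ := hb
      rw [hkb, hkd]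
    by_cases hc : ∃ i, c i = x
    · obtain ⟨i, rfl⟩ := hc
      rw [hkc, hkd]
    push Not at ha hb hc
    rw [hk x ha hb hc, hk x ha hb hc]
  obtain ⟨m, ma, mb, mc, hm⟩ := key b hab (Compatible.refl b) hbc.symm
  obtain ⟨l, la, lb, lc, hl⟩ := key c hac hbc (Compatible.refl c)
  have hml : m.1 * l.1 = l.1 := funext fun x => by
    change l.1 (m.1 x) = l.1 x
    by_cases ha : ∃ i, a i = x
    · obtain ⟨i, rfl⟩ := ha
      rw [ma, lb, la]
    by_cases hb : ∃ i, b i = x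
    · obtain ⟨i, rfl⟩ := hb
      rw [mb]
    by_cases hc : ∃ i, c i = x
    · obtain ⟨i, rfl⟩ := hc
      rw [mc, lb, lc]
    push Not at ha hb hc
    rw [hm x ha hb hc]
  have hyb := hy.mul_of hr (slide_apply a b hab)
  rw [hyb.mul_of_congr (slide_apply b c hbc) lb, hy.mul_of_congr (slide_apply a b hab) ma,
    hy.mul_of_congr (slide_apply a c hac) la, mul_assoc, of_mul_of_eq_right hml]

/-- The placements of `r` points, with the elements of the `R`-class of `e` lying above them. -/
noncomputable def transport (hr : 0 < r) (e : Idempotents (FullTransformation n))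
    (a₀ : Fin r ↪ Fin n) : TransportSystem (Fin r) (Fin n) (IG (FullTransformation n)) where
  fib a := {y | of e * y = y ∧ (∀ i, toSemigroup y (a₀ i) = a i) ∧ Absorbs y a}
  map a b h y := y * of (slide a b h)
  map_mem a b h y hy := ⟨by rw [← mul_assoc, hy.1], fun i => by
    rw [toSemigroup_mul_apply, hy.2.1, toSemigroup_of, slide_apply],
    hy.2.2.mul_of hr (slide_apply a b h)⟩
  map_refl a h y hy := hy.2.2 _ (slide_apply a a h)
  map_map a b c hab hbc hac y hy := hy.2.2.mul_slide_mul_slide hr hab hbc hac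

/-- Right multiplication acts on a flat section as on placements. -/
theorem isFlat_mul {hr : 0 < r} {e : Idempotents (FullTransformation n)} {a₀ : Fin r ↪ Fin n}
    {s : (Fin r ↪ Fin n) → IG (FullTransformation n)}
    (hs : (transport hr e a₀).IsFlat Set.univ s) (x : IG (FullTransformation n)) :
    ∀ a b : Fin r ↪ Fin n, (∀ i, toSemigroup x (a i) = b i) → s a * x = s b := by
  have hof : ∀ (f : Idempotents (FullTransformation n)) (a b : Fin r ↪ Fin n),
      (∀ i, f.1 (a i) = b i) → s a * of f = s b := by
    intro f a b hf
    have h := compatible_of_apply hf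
    rw [← hs.map_eq a trivial b trivial h]
    exact (hs.mem a trivial).2.2.mul_of_eq_mul_slide h hf
  induction x using induction_on with
  | of f => exact hof f
  | of_mul f x ih =>
    intro a b h
    have h' : ∀ i, toSemigroup x (f.1 (a i)) = b i := fun i => by
      rw [← h, toSemigroup_mul_apply, toSemigroup_of]
    -- The intermediate points are distinct because `x` sends them to the distinct points of `b`.
    let c : Fin r ↪ Fin n := ⟨fun i => f.1 (a i), fun i j hij => b.injective <| by
      rw [← h', ← h']
      exact congrArg _ hij⟩
    rw [← mul_assoc, hof f a c fun _ => rfl, ih c b h']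

end IG

/-! ### The maximal subgroup as a symmetric group. -/

theorem mainTheorem1 (n r : ℕ) (hr : 1 ≤ r) (hrn : r + 2 ≤ n)
    (e : Idempotents (FullTransformation n)) (he : e.1.rank = r) :
    Nonempty (maximalSubgroup (IG.of e) (IG.isIdempotentElem_of e) ≃* Equiv.Perm (Fin r)) := by
  have hcard : Nat.card (Set.range e.1) = r := he
  let a₀' : Fin r ≃ Set.range e.1 := (Finite.equivFinOfCardEq hcard).symm
  let a₀ : Fin r ↪ Fin n := a₀'.toEmbedding.trans (Function.Embedding.subtype _)
  have ha₀ : ∀ x, ∃ i, a₀ i = e.1 x := fun x =>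
    ⟨a₀'.symm ⟨e.1 x, x, rfl⟩, by simp [a₀]⟩
  have hea₀ : ∀ i, e.1 (a₀ i) = a₀ i := fun i => by
    obtain ⟨x, hx⟩ := (a₀' i).2
    change e.1 (a₀' i).1 = (a₀' i).1
    rw [← hx, IG.idempotent_apply_apply]
  have hmem : IG.of e ∈ (IG.transport hr e a₀).fib a₀ := by
    refine ⟨IG.isIdempotentElem_of e, hea₀, fun f hf => IG.of_mul_of_eq_left <| funext fun x => ?_⟩
    obtain ⟨i, hi⟩ := ha₀ x
    rw [FullTransformation.mul_apply, ← hi, hf]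
  obtain ⟨s, hs, hse⟩ := TransportSystem.exists_isFlat (by simpa using hrn) hmem
  have hfib : ∀ a, s a ∈ (IG.transport hr e a₀).fib a := fun a => hs.mem a trivial
  -- The inverse compensates for left-to-right composition of mappings.
  let t : Equiv.Perm (Fin r) → IG (FullTransformation n) := fun π =>
    s (π⁻¹.toEmbedding.trans a₀)
  have ht1 : t 1 = IG.of e := hse
  have htφ : ∀ π i, IG.toSemigroup (t π) (a₀ i) = a₀ (π⁻¹ i) := fun π => (hfib _).2.1
  have htmul : ∀ π ρ, t π * t ρ = t (π * ρ) := fun π ρ => by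
    refine IG.isFlat_mul hs _ _ _ fun i => ?_
    simp only [mul_inv_rev]
    exact htφ ρ (π⁻¹ i)
  have htmem : ∀ π, t π ∈ maximalSubgroup (IG.of e) (IG.isIdempotentElem_of e) := fun π =>
    ⟨by rw [← ht1, htmul, one_mul], by rw [← ht1, htmul, mul_one], t π⁻¹,
      by rw [← ht1, htmul, one_mul], by rw [← ht1, htmul, mul_one],
      by rw [← ht1, htmul, mul_inv_cancel], by rw [← ht1, htmul, inv_mul_cancel]⟩
  let F : Equiv.Perm (Fin r) →ₙ* maximalSubgroup (IG.of e) (IG.isIdempotentElem_of e) :=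
    { toFun := fun π => ⟨t π, htmem π⟩
      map_mul' := fun π ρ => Subtype.ext (htmul π ρ).symm }
  refine ⟨(MulEquiv.ofBijective F ⟨fun π ρ h => ?_, ?_⟩).symm⟩
  · have h' : t π = t ρ := congrArg Subtype.val h
    refine inv_injective <| Equiv.ext fun i => a₀.injective ?_
    rw [← htφ, ← htφ, h']
  · rintro ⟨x, hx1, hx2, y, -, -, hxy, -⟩
    -- Since `x e = x`, the mapping under `x` takes values in the image of `e`.
    have hx : ∀ i, ∃ j, a₀ j = IG.toSemigroup x (a₀ i) := fun i => by
      obtain ⟨j, hj⟩ := ha₀ (IG.toSemigroup x (a₀ i))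
      refine ⟨j, hj.trans ?_⟩
      conv_rhs => rw [← hx2, IG.toSemigroup_mul_apply, IG.toSemigroup_of]
    choose σ hσ using hx
    have hσi : Function.Injective σ := fun i j hij => a₀.injective <| by
      have h : ∀ i, a₀ i = IG.toSemigroup y (a₀ (σ i)) := fun i => by
        rw [hσ, ← IG.toSemigroup_mul_apply, hxy, IG.toSemigroup_of, hea₀]
      rw [h i, h j, hij]
    let π : Equiv.Perm (Fin r) := Equiv.ofBijective σ (Finite.injective_iff_bijective.1 hσi)
    refine ⟨π⁻¹, Subtype.ext ?_⟩
    change t π⁻¹ = x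
    -- `x = e x` is the section's value at `a₀` times `x`, hence again a value of the section.
    rw [← hx1, ← hse]
    refine (IG.isFlat_mul hs _ _ _ fun i => ?_).symm
    rw [← hσ]
    rfl
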